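/- A \emph{game} $G$ in an idealized model consists of a query set $X$, an answer set $Y$, a finite set $\Omega$ of oracles, where an oracle $\omega\in\Omega$ answers each query $x\in X$ with some $\omega(x)\in Y$ (for instance $\Omega$ is the set of all functions $[M]\to[N]$), a probability distribution $\mu$ on $\Omega$, for each $\omega$ a (discrete) challenge distribution $\pi_\omega$, and for each oracle $\omega$ and challenge $\mathsf{ch}$ a (possibly empty) set $\mathcal R_{\omega,\mathsf{ch}}$ of accepted outputs. A (possibly randomized) query algorithm $\mathcal A$, given a challenge $\mathsf{ch}$ and query access to $\omega$, wins if its output lies in $\mathcal R_{\omega,\mathsf{ch}}$; the probability is over $\omega\sim\mu$, $\mathsf{ch}\sim\pi_\omega$ and the internal randomness of $\mathcal A$. For $S,T\in\mathbb N$ let $\varepsilon_G(T)$ be the optimal (supremal) winning probability of algorithms making at most $T$ classical queries, and let $\varepsilon_G(S,T)$ be the optimal winning probability of algorithms making at most $T$ classical queries that additionally receive an advice string $\sigma_\omega\in\{0,1\}^S$ which may depend arbitrarily on $\omega$ but not on the challenge. Algorithms are computationally unbounded. For $K\ge 1$, the \emph{salted game} $G_K$ is the following game. The oracle is $g=(\omega_1,\dots,\omega_K)$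 with $\omega_1,\dots,\omega_K\sim\mu$ independent; a query $(i,x)\in[K]\times X$ is answered by $\omega_i(x)$; the challenge is $(k,\mathsf{ch})$ with $k$ uniform in $[K]$ and then $\mathsf{ch}\sim\pi_{\omega_k}$; the set of accepted outputs is $\mathcal R_{\omega_k,\mathsf{ch}}$. \textbf{Theorem.} For every game $G$ in any idealized model, every $K\ge 1$ and all $S,T\in\mathbb N$, $$\varepsilon_{G_K}(S,T)\le 2\,\varepsilon_G(T)+\frac{2S}{K}\qquad\text{and}\qquad \varepsilon_{G_K}(S,T)\le \varepsilon_G(T)+4\sqrt{\frac SK}.$$ -/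

import Mathlib

open scoped ENNReal

/-- A deterministic classical query algorithm (a decision tree): it either halts with an output in
`W`, or makes a query in `X` and continues in a way that may depend on the answer in `Y`. -/
inductive QueryAlg (X Y W : Type*) where
  | output (w : W) : QueryAlg X Y W
  | query (x : X) (next : Y → QueryAlg X Y W) : QueryAlg X Y W

namespace QueryAlg

variable {X Y W : Type*}

/-- The output of the algorithm when its queries are answered by `f`. -/
def run (f : X → Y) : QueryAlg X Y W → W
  | output w => w
  | query x next => run f (next (f x))

/-- The algorithm makes at most `T` queries on every computation path. -/
def AtMost : QueryAlg X Y W → ℕ → Prop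
  | output _, _ => True
  | query _ _, 0 => False
  | query _ next, T + 1 => ∀ y, AtMost (next y) T

end QueryAlg

/-- A game in an idealized model. `Ω` is the set of possible oracles, `answer ω x` is the answer of
the oracle `ω` to the query `x`, `oracle` is the oracle distribution, `challenge ω` the challenge
distribution of the oracle `ω`, and `accept ω c` the set of accepted outputs for the oracle `ω` and
the challenge `c`, possibly empty. Oracles that are functions `X → Y` with value queries are the
case `Ω = (X → Y)`, `answer = id`; games without challenge are the case `C = Unit`. -/
structure Game (Ω X Y C W : Type*) where
  answer : Ω → X → Y
  oracle : PMF Ω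
  challenge : Ω → PMF C
  accept : Ω → C → Set W

/-- The product distribution of `K` independent samples of `μ`. -/
noncomputable def iidPMF {Ω : Type*} [Fintype Ω] (μ : PMF Ω) (K : ℕ) : PMF (Fin K → Ω) :=
  PMF.ofFintype (fun g => ∏ i, μ (g i)) (by
    have h := Finset.prod_univ_sum (fun _ : Fin K => (Finset.univ : Finset Ω)) (fun _ ω => μ ω)
    rw [Fintype.piFinset_univ] at h
    rw [← h]
    have h1 : ∑ ω, μ ω = 1 := (tsum_fintype (fun ω => μ ω)).symm.trans μ.tsum_coe
    simp [h1])

namespace Game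

variable {Ω X Y C W : Type*}

/-- The winning probability of a randomized algorithm, given as a distribution over deterministic
algorithms that receive the challenge. -/
noncomputable def winProb (G : Game Ω X Y C W) (A : PMF (C → QueryAlg X Y W)) : ℝ≥0∞ :=
  ∑' a, A a * ∑' ω, G.oracle ω *
    (G.challenge ω).toOuterMeasure {c | (a c).run (G.answer ω) ∈ G.accept ω c}

/-- The winning probability of a randomized algorithm that also receives the `S`-bit advice string
`σ ω`, which depends on the oracle `ω` only. -/
noncomputable def winProbAdvice (G : Game Ω X Y C W) {S : ℕ}
    (A : PMF ((Fin S → Bool) → C → QueryAlg X Y W)) (σ : Ω → Fin S → Bool) : ℝ≥0∞ :=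
  ∑' a, A a * ∑' ω, G.oracle ω *
    (G.challenge ω).toOuterMeasure {c | (a (σ ω) c).run (G.answer ω) ∈ G.accept ω c}

/-- The optimal winning probability of randomized algorithms with at most `T` queries. -/
noncomputable def uniformValue (G : Game Ω X Y C W) (T : ℕ) : ℝ :=
  (⨆ (A : PMF (C → QueryAlg X Y W)) (_ : ∀ a ∈ A.support, ∀ c, (a c).AtMost T),
    G.winProb A).toReal

/-- The optimal winning probability of randomized algorithms with `S` bits of oracle-dependent
advice and at most `T` queries. -/
noncomputable def nonuniformValue (G : Game Ω X Y C W) (S T : ℕ) : ℝ :=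
  (⨆ (A : PMF ((Fin S → Bool) → C → QueryAlg X Y W))
    (_ : ∀ a ∈ A.support, ∀ s c, (a s c).AtMost T) (σ : Ω → Fin S → Bool),
    G.winProbAdvice A σ).toReal

/-- The salted game with salt space `Fin K`: the oracle consists of `K` independent oracles of `G`,
a query names one of them and a query to it, and the challenge is a uniformly random salt `k`
together with a challenge of `G` for the `k`-th oracle. -/
noncomputable def salted [Fintype Ω] (G : Game Ω X Y C W) (K : ℕ) [NeZero K] :
    Game (Fin K → Ω) (Fin K × X) Y (Fin K × C) W where
  answer g q := G.answer (g q.1) q.2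
  oracle := iidPMF G.oracle K
  challenge g := (PMF.uniformOfFintype (Fin K)).bind fun k => (G.challenge (g k)).map (Prod.mk k)
  accept g c := G.accept (g c.1) c.2

/-- Winning probabilities are at most `1`, so the suprema above are finite. -/
theorem winProb_le_one (G : Game Ω X Y C W) (A : PMF (C → QueryAlg X Y W)) :
    G.winProb A ≤ 1 := by
  have key : ∀ (ω : Ω) (s : Set C), (G.challenge ω).toOuterMeasure s ≤ 1 := fun ω s =>
    ((G.challenge ω).toOuterMeasure.mono (Set.subset_univ s)).trans
      (((G.challenge ω).toOuterMeasure_apply_eq_one_iff _).2 (Set.subset_univ _)).le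
  calc G.winProb A ≤ ∑' a, A a * ∑' ω, G.oracle ω * 1 := by
        unfold winProb; gcongr; exact key _ _
    _ = 1 := by simp [PMF.tsum_coe]

theorem winProbAdvice_le_one (G : Game Ω X Y C W) {S : ℕ}
    (A : PMF ((Fin S → Bool) → C → QueryAlg X Y W)) (σ : Ω → Fin S → Bool) :
    G.winProbAdvice A σ ≤ 1 := by
  have key : ∀ (ω : Ω) (s : Set C), (G.challenge ω).toOuterMeasure s ≤ 1 := fun ω s =>
    ((G.challenge ω).toOuterMeasure.mono (Set.subset_univ s)).trans
      (((G.challenge ω).toOuterMeasure_apply_eq_one_iff _).2 (Set.subset_univ _)).le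
  calc G.winProbAdvice A σ ≤ ∑' a, A a * ∑' ω, G.oracle ω * 1 := by
        unfold winProbAdvice; gcongr; exact key _ _
    _ = 1 := by simp [PMF.tsum_coe]

end Game

/-! Fix the advice and draw independent challenges, one per salt. This gives `K` algorithms, the
`k`-th scored on the `k`-th oracle but free to query all of them.
`QueryAlg.sum_prod_score_le_prod_potential` shows that the expected product of their scores is at
most the product of the separate optima: queries to foreign oracles do not help. The proof advances
selected algorithms by one query each. Each active algorithm points to the oracle it is about to
query; one either takes a single query to the oracle of a halted algorithm, or a set of algorithms
that query each other's oracles injectively. A halted score is linear in the oracle weight, so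
conditioning it is free; in the second case the query spent by an algorithm pays for the one query
its oracle receives. With scores `1 + s * win` this yields `E ∏ (1 + s p_k) ≤ (1 + s ε)^K`, where
`p_k` is the winning probability for salt `k` and `ε` the value without advice. For `s = exp l - 1`,
convexity of `exp`, Jensen and a sum over the `2 ^ S` advice strings give `l V ≤ S / K + (exp l - 1)
ε` for the salted value `V`. Both bounds follow by choosing `l`. -/

/-- In a finite functional graph with sinks, some nonempty set of non-sinks is mapped injectively
into itself and the sinks. -/
theorem exists_injOn_closed_or_sink {ι : Type*} [Finite ι] (f : ι → Option ι)
    (hf : ∃ i, f i ≠ none) :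
    ∃ I : Finset ι, I.Nonempty ∧ (∀ i ∈ I, ∃ j, f i = some j ∧ (j ∈ I ∨ f j = none)) ∧
      ∀ i ∈ I, ∀ i' ∈ I, f i = f i' → i = i' := by
  classical
  by_cases h : ∃ i j, f i = some j ∧ f j = none
  · obtain ⟨i, j, hij, hj⟩ := h
    exact ⟨{i}, by simp, by simp [hij, hj], by simp⟩
  -- Now no edge enters a sink, so the non-sinks are closed under `f`. On a closed nonempty set of
  -- least size `f` is onto, since the image is again closed, and hence injective.
  push Not at h
  let p : Finset ι → Prop := fun s => s.Nonempty ∧ (∀ i ∈ s, f i ≠ none) ∧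
    ∀ i ∈ s, ∀ j, f i = some j → j ∈ s
  have := Fintype.ofFinite ι
  have hp : p (Finset.univ.filter fun i => f i ≠ none) := by
    refine ⟨?_, by simp, ?_⟩
    · obtain ⟨i, hi⟩ := hf
      exact ⟨i, by simp [hi]⟩
    · intro i _ j hij
      simpa using h i j hij
  obtain ⟨s, hs, hmin⟩ := (Set.toFinite {s | p s}).exists_minimalFor Finset.card _ ⟨_, hp⟩
  obtain ⟨hne, hsome, hclosed⟩ := hs
  have hget : ∀ i ∈ s, ∃ j ∈ s, f i = some j := fun i hi => by
    obtain ⟨j, hj⟩ := Option.ne_none_iff_exists'.1 (hsome i hi)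
    exact ⟨j, hclosed i hi j hj, hj⟩
  choose! k hks hk using hget
  have himg : s.image k ⊆ s := by
    intro j hj
    obtain ⟨i, hi, rfl⟩ := Finset.mem_image.1 hj
    exact hks i hi
  have hpi : p (s.image k) := by
    refine ⟨hne.image k, fun i hi => hsome i (himg hi), fun i hi j hij => ?_⟩
    rw [hk i (himg hi)] at hij
    exact Finset.mem_image.2 ⟨i, himg hi, Option.some.inj hij⟩
  have hcard : (s.image k).card = s.card :=
    le_antisymm Finset.card_image_le (hmin hpi Finset.card_image_le)
  have hinj := Finset.card_image_iff.1 hcard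
  refine ⟨s, hne, fun i hi => ⟨k i, hk i hi, Or.inl (hks i hi)⟩, fun i hi i' hi' hii => ?_⟩
  rw [hk i hi, hk i' hi'] at hii
  exact hinj hi hi' (Option.some.inj hii)

/-! ### Decision trees and the product bound -/

namespace QueryAlg

variable {Ω X Y W : Type*} [Fintype Ω]

theorem AtMost.mono {a : QueryAlg X Y W} {m n : ℕ} (h : a.AtMost m) (hmn : m ≤ n) :
    a.AtMost n := by
  induction a generalizing m n with
  | output w => trivial
  | query x next ih =>
    cases m with
    | zero => exact h.elim
    | succ m =>
      obtain ⟨n, rfl⟩ : ∃ n', n = n' + 1 := ⟨n - 1, by omega⟩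
      exact fun y => ih y (h y) (by omega)

/-- The optimal total score of a `t`-query algorithm against an oracle with weights `ν`. -/
noncomputable def bestScore (answer : Ω → X → Y) (r : Ω → W → ℝ≥0∞) (ν : Ω → ℝ≥0∞) (t : ℕ) :
    ℝ≥0∞ :=
  ⨆ (a : QueryAlg X Y W) (_ : a.AtMost t), ∑ ω, ν ω * r ω (a.run (answer ω))

theorem le_bestScore (answer : Ω → X → Y) (r : Ω → W → ℝ≥0∞) (ν : Ω → ℝ≥0∞) {t : ℕ}
    {a : QueryAlg X Y W} (ha : a.AtMost t) :
    ∑ ω, ν ω * r ω (a.run (answer ω)) ≤ bestScore answer r ν t :=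
  le_iSup₂_of_le a ha le_rfl

theorem bestScore_mono (answer : Ω → X → Y) (r : Ω → W → ℝ≥0∞) (ν : Ω → ℝ≥0∞) {m n : ℕ}
    (h : m ≤ n) : bestScore answer r ν m ≤ bestScore answer r ν n :=
  iSup₂_le fun _ ha => le_bestScore answer r ν (ha.mono h)

/-- The optimal score is attained when the scores take finitely many values. -/
theorem exists_eq_bestScore [Nonempty W] (answer : Ω → X → Y) {r : Ω → W → ℝ≥0∞}
    (hr : (Set.range fun p : Ω × W => r p.1 p.2).Finite) (ν : Ω → ℝ≥0∞) (t : ℕ) :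
    ∃ a : QueryAlg X Y W, a.AtMost t ∧
      ∑ ω, ν ω * r ω (a.run (answer ω)) = bestScore answer r ν t := by
  -- Only the score vector indexed by `Ω` matters, and there are finitely many of these even if `X`,
  -- `Y` and `W` are infinite.
  let S : Set (Ω → ℝ≥0∞) :=
    (fun (a : QueryAlg X Y W) ω => r ω (a.run (answer ω))) '' {a | a.AtMost t}
  have hS : S.Finite := by
    refine (Set.Finite.pi (t := fun _ : Ω => Set.range fun p : Ω × W => r p.1 p.2)
      fun _ => hr).subset ?_
    rintro _ ⟨a, -, rfl⟩ ω -
    exact ⟨(ω, _), rfl⟩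
  have hne : S.Nonempty := ⟨_, output (Classical.arbitrary W), trivial, rfl⟩
  obtain ⟨_, ⟨a, ha, rfl⟩, hmax⟩ := Set.exists_max_image S (fun s => ∑ ω, ν ω * s ω) hS hne
  exact ⟨a, ha, le_antisymm (le_bestScore answer r ν ha)
    (iSup₂_le fun b hb => hmax _ ⟨b, hb, rfl⟩)⟩

open Classical in
-- With one more query, an algorithm can ask `x` first and then play optimally against the weight
-- conditioned on the answer.
theorem sum_bestScore_le_succ [Nonempty W] (answer : Ω → X → Y) {r : Ω → W → ℝ≥0∞}
    (hr : (Set.range fun p : Ω × W => r p.1 p.2).Finite) (ν : Ω → ℝ≥0∞) (t : ℕ)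
    (κ : Ω → Option Y) (x : X) (hκ : ∀ ω, κ ω = some (answer ω x)) :
    ∑ y ∈ Finset.univ.image κ, bestScore answer r (fun ω => if κ ω = y then ν ω else 0) t ≤
      bestScore answer r ν (t + 1) := by
  choose b hb hbe using fun y : Option Y =>
    exists_eq_bestScore answer hr (fun ω => if κ ω = y then ν ω else 0) t
  refine le_trans (le_of_eq ?_)
    (le_bestScore answer r ν (a := query x fun y => b (some y)) fun y => hb (some y))
  simp_rw [← hbe]
  rw [Finset.sum_comm]
  refine Finset.sum_congr rfl fun ω _ => ?_
  rw [Finset.sum_eq_single (κ ω)]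
  · simp [run, hκ]
  · intro y _ hy
    simp [hy.symm]
  · simp

/-- The score still to be expected in a run of `a`: the current one if `a` has halted, the optimal
one otherwise. -/
noncomputable def potential (answer : Ω → X → Y) {V : Type*} (r : Ω → W → ℝ≥0∞) (ν : Ω → ℝ≥0∞)
    (a : QueryAlg V Y W) (t : ℕ) : ℝ≥0∞ :=
  match a with
  | output w => ∑ ω, ν ω * r ω w
  | query _ _ => bestScore answer r ν t

theorem potential_le (answer : Ω → X → Y) {V : Type*} (r : Ω → W → ℝ≥0∞) (ν : Ω → ℝ≥0∞)
    (a : QueryAlg V Y W) (t : ℕ) : potential answer r ν a t ≤ bestScore answer r ν t := by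
  cases a with
  | output w => exact le_bestScore answer r ν (a := output w) trivial
  | query => exact le_rfl

/-- Splitting a weight along a constant map does not change a functional of it. -/
theorem sum_le_of_forall_eq {D : Type*} [DecidableEq D] (κ : Ω → D) (d : D) (hκ : ∀ ω, κ ω = d)
    (ν : Ω → ℝ≥0∞) (F : (Ω → ℝ≥0∞) → ℝ≥0∞) :
    ∑ y ∈ Finset.univ.image κ, F (fun ω => if κ ω = y then ν ω else 0) ≤ F ν := by
  refine (Finset.sum_le_sum_of_subset (t := {d}) ?_).trans ?_
  · intro y hy
    obtain ⟨ω, -, rfl⟩ := Finset.mem_image.1 hy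
    simp [hκ]
  · simp [hκ]

/-- The queried coordinate, if the algorithm has not halted. -/
def target {ι : Type*} : QueryAlg (ι × X) Y W → Option ι
  | output _ => none
  | query q _ => some q.1

/-- Algorithms for independent oracles that may query each other's oracles gain nothing: the
expected product of their scores is at most the product of the optimal scores. -/
theorem sum_prod_score_le_prod_potential {ι : Type*} [Fintype ι] [DecidableEq ι]
    [Nonempty W]
    (answer : Ω → X → Y) {r : ι → Ω → W → ℝ≥0∞}
    (hr : ∀ i, (Set.range fun p : Ω × W => r i p.1 p.2).Finite) (n : ℕ)
    (ν : ι → Ω → ℝ≥0∞) (a : ι → QueryAlg (ι × X) Y W) (t : ι → ℕ)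
    (ha : ∀ i, (a i).AtMost (t i)) (hn : ∑ i, t i ≤ n) :
    ∑ g : ι → Ω, ∏ i, (ν i (g i) * r i (g i) ((a i).run fun q => answer (g q.1) q.2)) ≤
      ∏ i, potential answer (r i) (ν i) (a i) (t i) := by
  classical
  induction n using Nat.strong_induction_on generalizing ν a t with
  | _ n ih =>
  by_cases hf : ∃ i, target (a i) ≠ none
  swap
  · push Not at hf
    have hout : ∀ i, ∃ w, a i = output w := fun i => by
      have h := hf i
      cases hi : a i with
      | output w => exact ⟨w, rfl⟩
      | query q next => simp [hi, target] at h
    choose w hw using hout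
    simp only [hw, run, potential]
    rw [Finset.prod_univ_sum, Fintype.piFinset_univ]
  -- Injectivity means that each oracle gets at most one query in this round; closedness means that
  -- no active algorithm outside `I`, whose budget stays put, has its oracle queried.
  obtain ⟨I, ⟨i₀, hi₀⟩, hI, hinj⟩ := exists_injOn_closed_or_sink (fun i => target (a i)) hf
  have hq : ∀ i ∈ I, ∃ (j : ι) (x : X) (next : Y → QueryAlg (ι × X) Y W),
      a i = query (j, x) next ∧ (j ∈ I ∨ target (a j) = none) := fun i hi => by
    obtain ⟨j, hj, hj'⟩ := hI i hi
    cases hi : a i with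
    | output w => simp [hi, target] at hj
    | query q next =>
      simp only [hi, target, Option.some.injEq] at hj
      subst hj
      exact ⟨q.1, q.2, next, rfl, hj'⟩
  have : Nonempty X := ⟨(hq i₀ hi₀).choose_spec.choose⟩
  have : Nonempty ι := ⟨i₀⟩
  have : Nonempty (QueryAlg (ι × X) Y W) := ⟨a i₀⟩
  choose! f x next hstep hfI using hq
  have hfinj : ∀ i ∈ I, ∀ i' ∈ I, f i = f i' → i = i' := fun i hi i' hi' h =>
    hinj i hi i' hi' (by simp [hstep i hi, hstep i' hi', target, h])
  -- The answer given by oracle `j` in this round, `none` if it is not queried.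
  let κ : ι → Ω → Option Y := fun j ω =>
    if h : ∃ i ∈ I, f i = j then some (answer ω (x h.choose)) else none
  have hκ_some : ∀ i ∈ I, ∀ ω, κ (f i) ω = some (answer ω (x i)) := fun i hi ω => by
    have h : ∃ i' ∈ I, f i' = f i := ⟨i, hi, rfl⟩
    have : h.choose = i := hfinj _ h.choose_spec.1 _ hi h.choose_spec.2
    simp only [κ, dif_pos h, this]
  have hκ_none : ∀ j, (¬ ∃ i ∈ I, f i = j) → ∀ ω, κ j ω = none := fun j h ω => by
    simp only [κ, dif_neg h]
  have ht : ∀ i ∈ I, ∃ m, t i = m + 1 ∧ ∀ y, (next i y).AtMost m := fun i hi => by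
    have h := ha i
    rw [hstep i hi] at h
    cases hm : t i with
    | zero => rw [hm] at h; exact h.elim
    | succ m => rw [hm] at h; exact ⟨m, rfl, h⟩
  let t' : ι → ℕ := fun i => if i ∈ I then t i - 1 else t i
  -- The default output is never reached for the answer vectors `z` in the sum below: there `z (f
  -- i)` is an actual answer.
  let a' : (ι → Option Y) → ι → QueryAlg (ι × X) Y W := fun z i =>
    if i ∈ I then (z (f i)).elim (output (Classical.arbitrary W)) (next i) else a i
  let ν' : ι → Option Y → Ω → ℝ≥0∞ := fun i y ω => if κ i ω = y then ν i ω else 0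
  have ha' : ∀ z i, (a' z i).AtMost (t' i) := fun z i => by
    by_cases hi : i ∈ I
    · obtain ⟨m, hm, hm'⟩ := ht i hi
      simp only [a', t', if_pos hi, hm, Nat.add_sub_cancel]
      cases z (f i) with
      | none => trivial
      | some y => exact hm' y
    · simpa only [a', t', if_neg hi] using ha i
  have hlt : ∑ i, t' i < n := by
    refine lt_of_lt_of_le (Finset.sum_lt_sum (fun i _ => ?_) ⟨i₀, Finset.mem_univ _, ?_⟩) hn
    · simp only [t']
      split_ifs <;> omega
    · obtain ⟨m, hm, -⟩ := ht i₀ hi₀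
      simp only [t', if_pos hi₀, hm]
      omega
  let U : ι → Option Y → ℝ≥0∞ := fun j y =>
    if j ∈ I then bestScore answer (r j) (ν' j y) (t' j)
    else potential answer (r j) (ν' j y) (a j) (t' j)
  calc ∑ g : ι → Ω, ∏ i, (ν i (g i) * r i (g i) ((a i).run fun q => answer (g q.1) q.2))
      -- Split according to the answers: for each `g` only its own answer vector contributes. Given
      -- `z` the weight is still a product, so induction applies.
      = ∑ z ∈ Fintype.piFinset fun j => Finset.univ.image (κ j), ∑ g : ι → Ω,
          ∏ i, (ν' i (z i) (g i) *
            r i (g i) ((a' z i).run fun q => answer (g q.1) q.2)) := by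
        rw [Finset.sum_comm]
        refine Finset.sum_congr rfl fun g _ => ?_
        rw [Finset.sum_eq_single fun i => κ i (g i)]
        · refine Finset.prod_congr rfl fun i _ => ?_
          by_cases hi : i ∈ I
          · simp only [ν', a', if_pos hi, if_true, hκ_some i hi]
            rw [hstep i hi]
            rfl
          · simp only [ν', a', if_neg hi, if_true]
        · intro z _ hz
          obtain ⟨i, hi⟩ := Function.ne_iff.1 hz
          refine Finset.prod_eq_zero (Finset.mem_univ i) ?_
          simp only [ν', if_neg hi.symm, zero_mul]
        · intro h
          exact absurd (Fintype.mem_piFinset.2 fun i =>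
            Finset.mem_image_of_mem _ (Finset.mem_univ _)) h
    _ ≤ ∑ z ∈ Fintype.piFinset fun j => Finset.univ.image (κ j), ∏ i, U i (z i) := by
        refine Finset.sum_le_sum fun z _ => ?_
        refine (ih _ hlt (fun i => ν' i (z i)) (a' z) t' (ha' z) le_rfl).trans ?_
        refine Finset.prod_le_prod' fun i _ => ?_
        by_cases hi : i ∈ I
        · simpa only [U, if_pos hi] using potential_le answer _ _ _ _
        · simp only [U, a', if_neg hi, le_refl]
    _ = ∏ i, ∑ y ∈ Finset.univ.image (κ i), U i y := (Finset.prod_univ_sum _ _).symm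
    _ ≤ ∏ i, potential answer (r i) (ν i) (a i) (t i) := by
        refine Finset.prod_le_prod' fun j _ => ?_
        -- For `j ∈ I` the budget drops by one, which pays for the possible query to oracle `j`.
        by_cases hj : j ∈ I
        · obtain ⟨m, hm, -⟩ := ht j hj
          simp only [U, t', if_pos hj, hm, Nat.add_sub_cancel]
          rw [hstep j hj]
          by_cases h : ∃ i ∈ I, f i = j
          · obtain ⟨i, hi, rfl⟩ := h
            exact sum_bestScore_le_succ answer (hr _) (ν _) m _ (x i) (hκ_some i hi)
          · exact (sum_le_of_forall_eq (κ j) none (hκ_none j h) (ν j)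
              fun ρ => bestScore answer (r j) ρ m).trans (bestScore_mono _ _ _ (Nat.le_succ m))
        -- Outside `I`, either `j` has halted and its score is additive in the weight, or oracle `j`
        -- is not queried.
        · simp only [U, t', if_neg hj]
          cases haj : a j with
          | output w =>
            simp only [potential]
            rw [Finset.sum_comm]
            refine Finset.sum_le_sum fun ω _ => le_of_eq ?_
            simp [ν', ite_mul]
          | query q nx =>
            have h : ¬ ∃ i ∈ I, f i = j := by
              rintro ⟨i, hi, rfl⟩
              rcases hfI i hi with h | h
              · exact hj h
              · simp [haj, target] at h
            exact sum_le_of_forall_eq (κ j) none (hκ_none j h) (ν j)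
              fun ρ => bestScore answer (r j) ρ (t j)

end QueryAlg

theorem ENNReal.prod_tsum_fin {C : Type*} (K : ℕ) (f : Fin K → C → ℝ≥0∞) :
    ∏ i, ∑' c, f i c = ∑' c : Fin K → C, ∏ i, f i (c i) := by
  induction K with
  | zero => simp
  | succ K ih =>
    rw [← (Fin.consEquiv fun _ : Fin (K + 1) => C).tsum_eq, ENNReal.tsum_prod',
      Fin.prod_univ_succ, ih, ← ENNReal.tsum_mul_right]
    refine tsum_congr fun c => ?_
    rw [← ENNReal.tsum_mul_left]
    refine tsum_congr fun d => ?_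
    simp [Fin.consEquiv, Fin.prod_univ_succ]

/-! ### Moments of the winning probabilities over the salts -/

namespace Game

variable {Ω X Y C W : Type*}

/-- The winning probability of `b` for the salt `k` and the salted oracle `g`. -/
noncomputable def saltWinProb (G : Game Ω X Y C W) {K : ℕ}
    (b : Fin K × C → QueryAlg (Fin K × X) Y W) (g : Fin K → Ω) (k : Fin K) : ℝ≥0∞ :=
  (G.challenge (g k)).toOuterMeasure
    {c | (b (k, c)).run (fun q => G.answer (g q.1) q.2) ∈ G.accept (g k) c}

/-- `uniformValue` before the conversion to a real number. -/
noncomputable def optWinProb (G : Game Ω X Y C W) (T : ℕ) : ℝ≥0∞ :=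
  ⨆ (A : PMF (C → QueryAlg X Y W)) (_ : ∀ a ∈ A.support, ∀ c, (a c).AtMost T), G.winProb A

theorem optWinProb_le_one (G : Game Ω X Y C W) (T : ℕ) : G.optWinProb T ≤ 1 :=
  iSup₂_le fun A _ => G.winProb_le_one A

/-- The score `1 + s` for an accepted output and `1` for any other. -/
noncomputable def score (G : Game Ω X Y C W) (s : ℝ≥0∞) (c : C) (ω : Ω) (w : W) : ℝ≥0∞ :=
  1 + s * (G.accept ω c).indicator 1 w

/-- Makes the optimum attained for every challenge, so no error accumulates over a possibly infinite
challenge set. -/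
theorem finite_range_score (G : Game Ω X Y C W) (s : ℝ≥0∞) (c : C) :
    (Set.range fun p : Ω × W => G.score s c p.1 p.2).Finite := by
  refine (Set.toFinite {1 + s * 0, 1 + s * 1}).subset ?_
  rintro _ ⟨⟨ω, w⟩, rfl⟩
  by_cases h : w ∈ G.accept ω c <;> simp [score, h]

theorem tsum_challenge_mul_score (G : Game Ω X Y C W) (s : ℝ≥0∞) (ω : Ω) (w : C → W) :
    ∑' c, G.challenge ω c * G.score s c ω (w c) =
      1 + s * (G.challenge ω).toOuterMeasure {c | w c ∈ G.accept ω c} := by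
  simp only [score, mul_add, mul_one]
  rw [ENNReal.tsum_add, PMF.tsum_coe, PMF.toOuterMeasure_apply, ← ENNReal.tsum_mul_left]
  congr 1
  refine tsum_congr fun c => ?_
  by_cases h : w c ∈ G.accept ω c <;> simp [h, mul_comm]

theorem saltWinProb_le_one (G : Game Ω X Y C W) {K : ℕ}
    (b : Fin K × C → QueryAlg (Fin K × X) Y W) (g : Fin K → Ω) (k : Fin K) :
    G.saltWinProb b g k ≤ 1 :=
  ((G.challenge (g k)).toOuterMeasure.mono (Set.subset_univ _)).trans
    (((G.challenge (g k)).toOuterMeasure_apply_eq_one_iff _).2 (Set.subset_univ _)).le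

/-- A bound for deterministic algorithms bounds the value with advice. -/
theorem nonuniformValue_le (G : Game Ω X Y C W) (S T : ℕ) {B : ℝ} (hB : 0 ≤ B)
    (h : ∀ a : (Fin S → Bool) → C → QueryAlg X Y W, (∀ s c, (a s c).AtMost T) →
      ∀ σ : Ω → Fin S → Bool, (∑' ω, G.oracle ω * (G.challenge ω).toOuterMeasure
        {c | (a (σ ω) c).run (G.answer ω) ∈ G.accept ω c}).toReal ≤ B) :
    G.nonuniformValue S T ≤ B := by
  refine ENNReal.toReal_le_of_le_ofReal hB (iSup_le fun A => iSup₂_le fun hA σ => ?_)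
  calc G.winProbAdvice A σ ≤ ∑' a, A a * ENNReal.ofReal B := by
        refine ENNReal.tsum_le_tsum fun a => ?_
        by_cases ha : A a = 0
        · simp [ha]
        · refine mul_le_mul_right ?_ _
          have hle : ∑' ω, G.oracle ω * (G.challenge ω).toOuterMeasure
              {c | (a (σ ω) c).run (G.answer ω) ∈ G.accept ω c} ≤ 1 := by
            rw [← G.oracle.tsum_coe]
            refine ENNReal.tsum_le_tsum fun ω => mul_le_of_le_one_right' ?_
            exact ((G.challenge ω).toOuterMeasure.mono (Set.subset_univ _)).trans
              (((G.challenge ω).toOuterMeasure_apply_eq_one_iff _).2 (Set.subset_univ _)).le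
          exact (ENNReal.le_ofReal_iff_toReal_le (ne_top_of_le_ne_top ENNReal.one_ne_top hle)
            hB).2 (h a (hA a ((A.mem_support_iff a).2 ha)) σ)
    _ = ENNReal.ofReal B := by rw [ENNReal.tsum_mul_right, PMF.tsum_coe, one_mul]

theorem nonuniformValue_le_one (G : Game Ω X Y C W) (S T : ℕ) : G.nonuniformValue S T ≤ 1 :=
  ENNReal.toReal_le_of_le_ofReal zero_le_one (iSup_le fun A => iSup₂_le fun _ σ => by
    simpa using G.winProbAdvice_le_one A σ)

theorem uniformValue_le_one (G : Game Ω X Y C W) (T : ℕ) : G.uniformValue T ≤ 1 :=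
  ENNReal.toReal_le_of_le_ofReal zero_le_one ((G.optWinProb_le_one T).trans (by simp))

variable [Fintype Ω]

/-- Optimal algorithms for the separate challenges combine into one algorithm for `G`, since the
algorithm sees its challenge. -/
theorem tsum_bestScore_le [Nonempty W] (G : Game Ω X Y C W) (T : ℕ) (s : ℝ≥0∞) :
    ∑' c, QueryAlg.bestScore G.answer (G.score s c) (fun ω => G.oracle ω * G.challenge ω c) T ≤
      1 + s * G.optWinProb T := by
  choose a ha hbest using fun c => QueryAlg.exists_eq_bestScore G.answer
    (G.finite_range_score s c) (fun ω => G.oracle ω * G.challenge ω c) T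
  have hle : G.winProb (PMF.pure a) ≤ G.optWinProb T := by
    refine le_iSup₂_of_le (PMF.pure a) (fun b hb => ?_) le_rfl
    rw [PMF.support_pure, Set.mem_singleton_iff] at hb
    exact hb ▸ ha
  have hwin : G.winProb (PMF.pure a) = ∑ ω, G.oracle ω *
      (G.challenge ω).toOuterMeasure {c | (a c).run (G.answer ω) ∈ G.accept ω c} := by
    rw [winProb, tsum_eq_single a (fun b hb => by simp [hb]), tsum_fintype]
    simp
  have hone : ∑ ω, G.oracle ω = 1 := (tsum_fintype _).symm.trans G.oracle.tsum_coe
  calc _ = ∑' c, ∑ ω, G.oracle ω *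
        (G.challenge ω c * G.score s c ω ((a c).run (G.answer ω))) := by
        simp_rw [← hbest, mul_assoc]
    _ = ∑ ω, G.oracle ω * (1 + s *
        (G.challenge ω).toOuterMeasure {c | (a c).run (G.answer ω) ∈ G.accept ω c}) := by
        rw [Summable.tsum_finsetSum fun _ _ => ENNReal.summable]
        refine Finset.sum_congr rfl fun ω _ => ?_
        rw [ENNReal.tsum_mul_left,
          G.tsum_challenge_mul_score s ω fun c => (a c).run (G.answer ω)]
    _ = 1 + s * G.winProb (PMF.pure a) := by
        rw [hwin, Finset.mul_sum]
        simp only [mul_add, mul_one, Finset.sum_add_distrib, hone]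
        congr 1
        exact Finset.sum_congr rfl fun ω _ => mul_left_comm _ _ _
    _ ≤ _ := by gcongr

/-- The wins of one algorithm for the different salts are dominated by independent ones. -/
theorem sum_iidPMF_mul_prod_le [Nonempty W] (G : Game Ω X Y C W) {K : ℕ} (T : ℕ) (s : ℝ≥0∞)
    (b : Fin K × C → QueryAlg (Fin K × X) Y W) (hb : ∀ c, (b c).AtMost T) :
    ∑ g, iidPMF G.oracle K g * ∏ k, (1 + s * G.saltWinProb b g k) ≤
      (1 + s * G.optWinProb T) ^ K := by
  -- Given `g`, the product over salts is the expectation over independent challenges; each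
  -- challenge probability is then absorbed into the oracle weight.
  calc _ = ∑ g : Fin K → Ω, ∑' c : Fin K → C, ∏ k,
        ((G.oracle (g k) * G.challenge (g k) (c k)) * G.score s (c k) (g k)
          ((b (k, c k)).run fun q => G.answer (g q.1) q.2)) := by
        refine Finset.sum_congr rfl fun g _ => ?_
        simp_rw [mul_assoc, Finset.prod_mul_distrib (f := fun k => G.oracle (g k))]
        rw [ENNReal.tsum_mul_left]
        simp only [iidPMF, PMF.ofFintype_apply]
        congr 1
        rw [← ENNReal.prod_tsum_fin K fun k c => G.challenge (g k) c * G.score s c (g k)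
          ((b (k, c)).run fun q => G.answer (g q.1) q.2)]
        refine Finset.prod_congr rfl fun k _ => ?_
        rw [G.tsum_challenge_mul_score s (g k)
          fun c => (b (k, c)).run fun q => G.answer (g q.1) q.2]
        rfl
    _ = ∑' c : Fin K → C, ∑ g : Fin K → Ω, ∏ k,
        ((G.oracle (g k) * G.challenge (g k) (c k)) * G.score s (c k) (g k)
          ((b (k, c k)).run fun q => G.answer (g q.1) q.2)) :=
        (Summable.tsum_finsetSum fun _ _ => ENNReal.summable).symm
    _ ≤ ∑' c : Fin K → C, ∏ k, QueryAlg.bestScore G.answer (G.score s (c k))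
          (fun ω => G.oracle ω * G.challenge ω (c k)) T := by
        refine ENNReal.tsum_le_tsum fun c => ?_
        refine (QueryAlg.sum_prod_score_le_prod_potential G.answer
          (r := fun k => G.score s (c k)) (fun k => G.finite_range_score s (c k)) _
          (fun k ω => G.oracle ω * G.challenge ω (c k)) (fun k => b (k, c k)) (fun _ => T)
          (fun k => hb _) le_rfl).trans ?_
        exact Finset.prod_le_prod' fun k _ => QueryAlg.potential_le _ _ _ _ _
    _ = ∏ _k : Fin K, ∑' c, QueryAlg.bestScore G.answer (G.score s c)
          (fun ω => G.oracle ω * G.challenge ω c) T :=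
        (ENNReal.prod_tsum_fin K fun _ c =>
          QueryAlg.bestScore G.answer (G.score s c) (fun ω => G.oracle ω * G.challenge ω c) T).symm
    _ ≤ _ := by
        rw [Finset.prod_const, Finset.card_univ, Fintype.card_fin]
        exact pow_le_pow_left' (G.tsum_bestScore_le T s) K

theorem salted_challenge_apply (G : Game Ω X Y C W) (K : ℕ) [NeZero K]
    (b : Fin K × C → QueryAlg (Fin K × X) Y W) (g : Fin K → Ω) :
    ((G.salted K).challenge g).toOuterMeasure
        {c | (b c).run ((G.salted K).answer g) ∈ (G.salted K).accept g c} =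
      (K : ℝ≥0∞)⁻¹ * ∑ k, G.saltWinProb b g k := by
  simp only [salted]
  rw [PMF.toOuterMeasure_bind_apply, tsum_fintype, Finset.mul_sum]
  refine Finset.sum_congr rfl fun k _ => ?_
  rw [PMF.uniformOfFintype_apply, Fintype.card_fin, PMF.toOuterMeasure_map_apply]
  rfl

/-! ### Exponential moments and advice -/

/-- The exponential-moment bound for a deterministic algorithm with advice. -/
theorem exp_sum_le [Nonempty W] (G : Game Ω X Y C W) {K : ℕ} (S T : ℕ)
    (a : (Fin S → Bool) → Fin K × C → QueryAlg (Fin K × X) Y W) (ha : ∀ s c, (a s c).AtMost T)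
    (σ : (Fin K → Ω) → Fin S → Bool) {l : ℝ} (hl : 0 ≤ l) :
    Real.exp (l * ∑ g, (iidPMF G.oracle K g).toReal * ∑ k, (G.saltWinProb (a (σ g)) g k).toReal) ≤
      2 ^ S * (1 + (Real.exp l - 1) * G.uniformValue T) ^ K := by
  have hs : 0 ≤ Real.exp l - 1 := by linarith [Real.one_le_exp hl]
  have hμ : ∑ g, (iidPMF G.oracle K g).toReal = 1 := by
    rw [← ENNReal.toReal_sum fun g _ => PMF.apply_ne_top _ _, ← tsum_fintype (L := .unconditional _),
      PMF.tsum_coe, ENNReal.toReal_one]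
  have hp0 : ∀ b g k, 0 ≤ (G.saltWinProb (K := K) b g k).toReal := fun _ _ _ =>
    ENNReal.toReal_nonneg
  have hp1 : ∀ b g k, (G.saltWinProb (K := K) b g k).toReal ≤ 1 := fun b g k =>
    ENNReal.toReal_le_of_le_ofReal zero_le_one (by simpa using G.saltWinProb_le_one b g k)
  have hconv : ∀ p : ℝ, 0 ≤ p → p ≤ 1 → Real.exp (l * p) ≤ 1 + (Real.exp l - 1) * p := by
    intro p h0 h1
    have h := convexOn_exp.2 (Set.mem_univ 0) (Set.mem_univ l) (sub_nonneg.2 h1) h0 (by ring)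
    simp only [smul_eq_mul, mul_zero, zero_add, Real.exp_zero, mul_one] at h
    rw [mul_comm l p]
    linarith
  have hstep : ∀ b : Fin K × C → QueryAlg (Fin K × X) Y W, (∀ c, (b c).AtMost T) →
      ∑ g, (iidPMF G.oracle K g).toReal *
        ∏ k, (1 + (Real.exp l - 1) * (G.saltWinProb b g k).toReal) ≤
      (1 + (Real.exp l - 1) * G.uniformValue T) ^ K := by
    intro b hb
    have h := G.sum_iidPMF_mul_prod_le T (ENNReal.ofReal (Real.exp l - 1)) b hb
    have hfin : (1 + ENNReal.ofReal (Real.exp l - 1) * G.optWinProb T) ^ K ≠ ⊤ :=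
      ENNReal.pow_ne_top (ENNReal.add_ne_top.2 ⟨ENNReal.one_ne_top, ENNReal.mul_ne_top
        ENNReal.ofReal_ne_top (ne_top_of_le_ne_top ENNReal.one_ne_top (G.optWinProb_le_one T))⟩)
    have hadd : ∀ x : ℝ≥0∞, x ≤ 1 → (1 + ENNReal.ofReal (Real.exp l - 1) * x).toReal =
        1 + (Real.exp l - 1) * x.toReal := fun x hx => by
      rw [ENNReal.toReal_add ENNReal.one_ne_top (ENNReal.mul_ne_top ENNReal.ofReal_ne_top
        (ne_top_of_le_ne_top ENNReal.one_ne_top hx)), ENNReal.toReal_mul,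
        ENNReal.toReal_ofReal hs, ENNReal.toReal_one]
    have h' := ENNReal.toReal_mono hfin h
    rw [ENNReal.toReal_pow, hadd _ (G.optWinProb_le_one T), ENNReal.toReal_sum fun g hg =>
      ne_top_of_le_ne_top hfin (le_trans (Finset.single_le_sum
        (f := fun g => iidPMF G.oracle K g * ∏ k, (1 + ENNReal.ofReal (Real.exp l - 1) *
          G.saltWinProb b g k)) (fun _ _ => zero_le) hg) h)] at h'
    change _ ≤ (1 + (Real.exp l - 1) * (G.optWinProb T).toReal) ^ K
    simpa only [ENNReal.toReal_mul, ENNReal.toReal_prod, hadd _ (G.saltWinProb_le_one b _ _)]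
      using h'
  calc _ = Real.exp (∑ g, (iidPMF G.oracle K g).toReal •
        (l * ∑ k, (G.saltWinProb (a (σ g)) g k).toReal)) := by
        rw [Finset.mul_sum]
        simp only [smul_eq_mul, mul_left_comm]
    _ ≤ ∑ g, (iidPMF G.oracle K g).toReal •
        Real.exp (l * ∑ k, (G.saltWinProb (a (σ g)) g k).toReal) :=
        convexOn_exp.map_sum_le (fun _ _ => ENNReal.toReal_nonneg) hμ fun _ _ => Set.mem_univ _
    -- The term for the actual advice `σ g` is bounded by the sum over all fixed advice strings,
    -- which removes the dependence on `g`.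
    _ ≤ ∑ g, (iidPMF G.oracle K g).toReal * ∑ s,
        ∏ k, (1 + (Real.exp l - 1) * (G.saltWinProb (a s) g k).toReal) := by
        refine Finset.sum_le_sum fun g _ => mul_le_mul_of_nonneg_left ?_ ENNReal.toReal_nonneg
        rw [Finset.mul_sum, Real.exp_sum]
        refine (Finset.prod_le_prod (fun _ _ => (Real.exp_pos _).le)
          fun k _ => hconv _ (hp0 (a (σ g)) g k) (hp1 (a (σ g)) g k)).trans ?_
        exact Finset.single_le_sum
          (f := fun s => ∏ k, (1 + (Real.exp l - 1) * (G.saltWinProb (a s) g k).toReal))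
          (fun s _ => Finset.prod_nonneg fun k _ => by have := hp0 (a s) g k; positivity)
          (Finset.mem_univ (σ g))
    _ = ∑ s, ∑ g, (iidPMF G.oracle K g).toReal *
        ∏ k, (1 + (Real.exp l - 1) * (G.saltWinProb (a s) g k).toReal) := by
        simp only [Finset.mul_sum]
        exact Finset.sum_comm
    _ ≤ ∑ _s : Fin S → Bool, (1 + (Real.exp l - 1) * G.uniformValue T) ^ K :=
        Finset.sum_le_sum fun s _ => hstep (a s) (ha s)
    _ = _ := by simp

/-- The winning probability of a deterministic algorithm with advice against the salted game. -/
theorem mul_salted_winProb_le (G : Game Ω X Y C W) (K : ℕ) [NeZero K] (S T : ℕ)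
    (a : (Fin S → Bool) → Fin K × C → QueryAlg (Fin K × X) Y W) (ha : ∀ s c, (a s c).AtMost T)
    (σ : (Fin K → Ω) → Fin S → Bool) {l : ℝ} (hl : 0 ≤ l) :
    l * (∑' g, (G.salted K).oracle g * ((G.salted K).challenge g).toOuterMeasure
        {c | (a (σ g) c).run ((G.salted K).answer g) ∈ (G.salted K).accept g c}).toReal ≤
      S / K + (Real.exp l - 1) * G.uniformValue T := by
  -- Running the given algorithm once exhibits an element of `W`.
  obtain ⟨ω, -⟩ := G.oracle.support_nonempty
  obtain ⟨c, -⟩ := (G.challenge ω).support_nonempty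
  have : Nonempty W := ⟨(a (fun _ => false) (0, c)).run fun q => G.answer ω q.2⟩
  have hK : (0 : ℝ) < K := Nat.cast_pos.2 (Nat.pos_of_ne_zero (NeZero.ne K))
  have hs : 0 ≤ Real.exp l - 1 := by linarith [Real.one_le_exp hl]
  have hε : 0 ≤ G.uniformValue T := ENNReal.toReal_nonneg
  simp_rw [G.salted_challenge_apply K]
  have h := Real.log_le_log (Real.exp_pos _) (G.exp_sum_le S T a ha σ hl)
  rw [Real.log_exp, Real.log_mul (by positivity) (by positivity), Real.log_pow, Real.log_pow] at h
  have h2 : Real.log (1 + (Real.exp l - 1) * G.uniformValue T) ≤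
      (Real.exp l - 1) * G.uniformValue T := by
    have := Real.log_le_sub_one_of_pos (x := 1 + (Real.exp l - 1) * G.uniformValue T)
      (by positivity)
    linarith
  have h3 : (S : ℝ) * Real.log 2 ≤ S :=
    mul_le_of_le_one_right (Nat.cast_nonneg S) (by linarith [Real.log_two_lt_d9])
  have hfin : ∀ g k, G.saltWinProb (a (σ g)) g k ≠ ⊤ := fun g k =>
    ne_top_of_le_ne_top ENNReal.one_ne_top (G.saltWinProb_le_one _ g k)
  have heq : (∑' g, (G.salted K).oracle g * ((K : ℝ≥0∞)⁻¹ *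
      ∑ k, G.saltWinProb (a (σ g)) g k)).toReal = (K : ℝ)⁻¹ *
      ∑ g, (iidPMF G.oracle K g).toReal * ∑ k, (G.saltWinProb (a (σ g)) g k).toReal := by
    rw [tsum_fintype, Finset.mul_sum, ENNReal.toReal_sum]
    · refine Finset.sum_congr rfl fun g _ => ?_
      rw [ENNReal.toReal_mul, ENNReal.toReal_mul, ENNReal.toReal_inv, ENNReal.toReal_natCast,
        ENNReal.toReal_sum fun k _ => hfin g k, mul_left_comm]
      rfl
    · intro g _
      exact ENNReal.mul_ne_top (PMF.apply_ne_top _ _) (ENNReal.mul_ne_top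
        (ENNReal.inv_ne_top.2 (Nat.cast_ne_zero.2 (NeZero.ne K)))
        (ENNReal.sum_ne_top.2 fun k _ => hfin g k))
  rw [heq, mul_left_comm, inv_mul_le_iff₀ hK, mul_add, mul_div_cancel₀ _ hK.ne']
  have h4 := mul_le_mul_of_nonneg_left h2 hK.le
  linarith

/-- Randomness does not help, because the winning probability is an average over deterministic
algorithms. -/
theorem mul_nonuniformValue_salted_le (G : Game Ω X Y C W) (K : ℕ) [NeZero K] (S T : ℕ) {l : ℝ}
    (hl : 0 < l) :
    l * (G.salted K).nonuniformValue S T ≤ S / K + (Real.exp l - 1) * G.uniformValue T := by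
  have hs : 0 ≤ Real.exp l - 1 := by linarith [Real.one_le_exp hl.le]
  have hε : 0 ≤ G.uniformValue T := ENNReal.toReal_nonneg
  rw [← le_div_iff₀' hl]
  refine nonuniformValue_le _ S T (by positivity) fun a ha σ => ?_
  rw [le_div_iff₀' hl]
  exact G.mul_salted_winProb_le K S T a ha σ hl.le

end Game

/-! ### Choice of the parameter -/

theorem mainTheorem2 {Ω X Y C W : Type*} [Fintype Ω] (G : Game Ω X Y C W)
    (K : ℕ) [NeZero K] (S T : ℕ) :
    (G.salted K).nonuniformValue S T ≤ 2 * G.uniformValue T + 2 * (S : ℝ) / (K : ℝ) ∧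
    (G.salted K).nonuniformValue S T ≤ G.uniformValue T + 4 * Real.sqrt ((S : ℝ) / (K : ℝ)) := by
  have hε : 0 ≤ G.uniformValue T := ENNReal.toReal_nonneg
  have hε1 := G.uniformValue_le_one T
  have hq : (0 : ℝ) ≤ S / K := by positivity
  have key := fun (l : ℝ) (hl : 0 < l) => G.mul_nonuniformValue_salted_le K S T hl
  constructor
  -- Multiplicative bound: `l = 1` and `exp 1 - 1 ≤ 2`.
  · have h := key 1 one_pos
    have he : Real.exp 1 - 1 ≤ 2 := by linarith [Real.exp_one_lt_d9]
    have := mul_le_mul_of_nonneg_right he hε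
    rw [mul_div_assoc]
    linarith
  set q : ℝ := S / K
  set V := (G.salted K).nonuniformValue S T
  -- Additive bound: `exp l - 1 ≤ l + l ^ 2` on `(0, 1]`. The choice `l = √q` gives the error `2
  -- √q`; for `q = 0` let `l` tend to `0`, and for `√q > 1` the bound exceeds `1`.
  have hsmall : ∀ l : ℝ, 0 < l → l ≤ 1 → V ≤ G.uniformValue T + l + q / l := by
    intro l hl hl1
    have h := key l hl
    have he : Real.exp l - 1 ≤ l + l ^ 2 := by
      have := (abs_le.1 (Real.abs_exp_sub_one_sub_id_le (abs_le.2 ⟨by linarith, hl1⟩))).2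
      linarith
    have h1 := mul_le_mul_of_nonneg_right he hε
    have h2 : l ^ 2 * G.uniformValue T ≤ l ^ 2 := mul_le_of_le_one_right (by positivity) hε1
    refine le_of_mul_le_mul_left ?_ hl
    have h3 : l * (G.uniformValue T + l + q / l) = l * G.uniformValue T + l ^ 2 + q := by
      field_simp
    rw [h3]
    linarith
  rcases hq.eq_or_lt with h0 | hpos
  · rw [← h0, Real.sqrt_zero, mul_zero, add_zero]
    refine le_of_forall_pos_le_add fun δ hδ => ?_
    have h := hsmall (min δ 1) (lt_min hδ one_pos) (min_le_right _ _)
    rw [← h0, zero_div, add_zero] at h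
    linarith [min_le_left δ 1]
  · have hr := Real.sqrt_pos.2 hpos
    by_cases h1 : Real.sqrt q ≤ 1
    · have h := hsmall _ hr h1
      rw [Real.div_sqrt] at h
      linarith
    · have : V ≤ 1 := Game.nonuniformValue_le_one _ S T
      linarith
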